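/- Let $B$ be a unital algebra over $\mathbb C$. A $B$-$B$-non-commutative probability space is a triple $(\mathcal A,E,\varepsilon)$ where $\mathcal A$ is a unital complex algebra, $\varepsilon:B\otimes B^{\mathrm{op}}\to\mathcal A$ is a unital homomorphism that is injective on $B\otimes 1$ and on $1\otimes B^{\mathrm{op}}$, and $E:\mathcal A\to B$ is linear with $E(\varepsilon(b_1\otimes b_2)T)=b_1E(T)b_2$ and $E(T\varepsilon(b\otimes 1))=E(T\varepsilon(1\otimes b))$ for all $b,b_1,b_2\in B$, $T\in\mathcal A$. Write $L_b=\varepsilon(b\otimes 1)$, $R_b=\varepsilon(1\otimes b)$; let $\mathcal A_\ell$ be the set of $T\in\mathcal A$ commuting with all $R_b$ and $\mathcal A_r$ the set of $T\in\mathcal A$ commuting with all $L_b$. For $\chi:\{1,\dots,n\}\to\{\ell,r\}$ let $\prec_\chi$ be the total order on $\{1,\dots,n\}$ listing first the $k$ with $\chi(k)=\ell$ increasingly and then the $k$ with $\chi(k)=r$ decreasingly. $BNC(\chi)$ is the set of partitions of $\{1,\dots,n\}$ that are non-crossing with respect to $\prec_\chi$, ordered by refinement. It is a lattice; $0_\chi$,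 $1_\chi$ are its least and greatest elements, $\vee$ its join and $\mu_{BNC}$ its Möbius function. A partition in $BNC(\chi)$ is drawn with nodes $1,\dots,n$ from top to bottom, $k$ on the left line if $\chi(k)=\ell$ and on the right line if $\chi(k)=r$, each block having a vertical spine between the two lines from its smallest to its largest element, without crossings. For $\pi\in BNC(\chi)$ and $T_1,\dots,T_n\in\mathcal A$ define $E_\pi(T_1,\dots,T_n)\in B$ recursively. If $\pi$ has one block, $E_\pi(T_1,\dots,T_n)=E(T_1\cdots T_n)$. Otherwise let $V$ be the block with $v=\min V$ largest, let $b=E_{\pi|_V}((T_1,\dots,T_n)|_V)$ be $E$ of the product, in increasing order, of the entries $T_j$ with $j\in V$, and let $C=L_b$ if $\chi(v)=\ell$, $C=R_b$ if $\chi(v)=r$. If $V=\{k+1,\dots,n\}$, then replace $T_k$ by $T_kC$. Otherwise let $W$ be the block whose spine is adjacent to $v$ (among the blocks other than $V$ having elements both smaller and larger than $v$, the one with leftmost spine at the height of $v$ if $\chi(v)=\ell$, with rightmost spine if $\chi(v)=r$), let $k$ be the smallest element of $W$ larger than $v$, and replace $T_k$ by $CT_k$. In both cases $E_\pi(T_1,\dots,T_n)$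 is $E_{\pi|_{V^c}}$ of the new tuple restricted to $V^c$. For $T_k\in\mathcal A_{\chi(k)}$, write $\mathcal E_\pi(T_1,\dots,T_n)=E_\pi(T_1,\dots,T_n)$ and define the operator-valued bi-free cumulants \[ \kappa_\pi(T_1,\dots,T_n)=\sum_{\sigma\in BNC(\chi),\ \sigma\le\pi}\mathcal E_\sigma(T_1,\dots,T_n)\,\mu_{BNC}(\sigma,\pi). \] Theorem. Let $(\mathcal A,E,\varepsilon)$ be a $B$-$B$-non-commutative probability space, $m<n$ natural numbers, $\chi:\{1,\dots,m\}\to\{\ell,r\}$, and $0=k(0)<k(1)<\dots<k(m)=n$ integers. For $q\in\{1,\dots,n\}$ let $p_q$ be the unique $p$ with $k(p-1)<q\le k(p)$, put $\widehat\chi(q)=\chi(p_q)$, and for $\pi\in BNC(\chi)$ let $\widehat\pi\in BNC(\widehat\chi)$ be the partition in which $q,q'$ lie in the same block if and only if $p_q,p_{q'}$ lie in the same block of $\pi$. If $\pi\in BNC(\chi)$ and $T_q\in\mathcal A_{\widehat\chi(q)}$ for all $q\in\{1,\dots,n\}$, then \[ \kappa_\pi\bigl(T_1\cdots T_{k(1)},\,T_{k(1)+1}\cdots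 T_{k(2)},\,\dots,\,T_{k(m-1)+1}\cdots T_{k(m)}\bigr)=\sum_{\substack{\sigma\in BNC(\widehat\chi)\\ \sigma\vee\widehat{0_\chi}=\widehat\pi}}\kappa_\sigma(T_1,\dots,T_n). \] In particular, \[ \kappa_{1_\chi}\bigl(T_1\cdots T_{k(1)},\,\dots,\,T_{k(m-1)+1}\cdots T_{k(m)}\bigr)=\sum_{\substack{\sigma\in BNC(\widehat\chi)\\ \sigma\vee\widehat{0_\chi}=1_{\widehat\chi}}}\kappa_\sigma(T_1,\dots,T_n). \] -/

import Mathlib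

open scoped TensorProduct

namespace BiFree

noncomputable section

/-! ### Bi-non-crossing partitions -/

/-- The two sides `ℓ` and `r`. -/
inductive Side : Type
  | left
  | right

/-- The total order `≺_χ` on the nodes: first the left nodes in increasing order, then the right
nodes in decreasing order. That is, `a ≺_χ b` iff `s_χ⁻¹ a < s_χ⁻¹ b`. -/
def Precedes {n : ℕ} (χ : Fin n → Side) (a b : Fin n) : Prop :=
  match χ a, χ b with
  | Side.left, Side.left => a < b
  | Side.left, Side.right => True
  | Side.right, Side.left => False
  | Side.right, Side.right => b < a

/-- A partition of `{1, …, n}` (as an equivalence relation) is bi-non-crossing with respect to `χ`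
if `u₁ ≺ v₁ ≺ u₂ ≺ v₂` with `u₁, u₂` in a block `U` and `v₁, v₂` in a block `V` forces `U = V`. -/
def IsBNC {n : ℕ} (χ : Fin n → Side) (π : Setoid (Fin n)) : Prop :=
  ∀ u₁ v₁ u₂ v₂ : Fin n, Precedes χ u₁ v₁ → Precedes χ v₁ u₂ → Precedes χ u₂ v₂ →
    π u₁ u₂ → π v₁ v₂ → π u₁ v₁

/-- The set `BNC(χ)`; it is ordered by refinement: `π ≤ σ` iff every block of `π` is contained in a
block of `σ`. -/
def BNC {n : ℕ} (χ : Fin n → Side) : Type := {π : Setoid (Fin n) // IsBNC χ π}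

namespace BNC

variable {n : ℕ} {χ : Fin n → Side}

instance : PartialOrder (BNC χ) := inferInstanceAs (PartialOrder {π : Setoid (Fin n) // IsBNC χ π})

instance : Finite (BNC χ) :=
  Finite.of_injective (fun π : BNC χ => fun a b : Fin n => π.1 a b) (by
    intro π σ h
    apply Subtype.ext
    apply Setoid.ext
    intro a b
    exact iff_of_eq (congrFun (congrFun h a) b))

instance : Fintype (BNC χ) := Fintype.ofFinite _

instance : DecidableEq (BNC χ) := Classical.decEq _

instance : DecidableLE (BNC χ) := Classical.decRel _

instance : DecidableLT (BNC χ) := Classical.decRel _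

instance : LocallyFiniteOrder (BNC χ) := Fintype.toLocallyFiniteOrder

/-- Bi-non-crossing partitions are closed under intersections. -/
theorem isBNC_sInf (S : Set (Setoid (Fin n))) (hS : ∀ π ∈ S, IsBNC χ π) : IsBNC χ (sInf S) := by
  intro u₁ v₁ u₂ v₂ h₁ h₂ h₃ hu hv π hπ
  exact hS π hπ u₁ v₁ u₂ v₂ h₁ h₂ h₃ (hu π hπ) (hv π hπ)

/-- `π ⊔ σ` is the smallest bi-non-crossing partition above `π` and `σ`; `π ⊓ σ` is the common
refinement. -/
instance : Lattice (BNC χ) where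
  sup π σ := ⟨sInf {ρ | IsBNC χ ρ ∧ π.1 ≤ ρ ∧ σ.1 ≤ ρ}, isBNC_sInf _ fun _ h => h.1⟩
  inf π σ := ⟨sInf {π.1, σ.1}, isBNC_sInf _ (by
    rintro ρ (rfl | rfl)
    · exact π.2
    · exact σ.2)⟩
  le_sup_left π σ := show π.1 ≤ sInf _ from le_sInf fun _ h => h.2.1
  le_sup_right π σ := show σ.1 ≤ sInf _ from le_sInf fun _ h => h.2.2
  sup_le π σ ρ h₁ h₂ := show sInf _ ≤ ρ.1 from sInf_le ⟨ρ.2, h₁, h₂⟩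
  inf_le_left π σ := show sInf _ ≤ π.1 from sInf_le (by simp)
  inf_le_right π σ := show sInf _ ≤ σ.1 from sInf_le (by simp)
  le_inf ρ π σ h₁ h₂ := show ρ.1 ≤ sInf _ from le_sInf (by
    rintro τ (rfl | rfl)
    · exact h₁
    · exact h₂)

/-- `⊤` is the one-block partition `1_χ` and `⊥` the partition `0_χ` into singletons. -/
instance : BoundedOrder (BNC χ) where
  top := ⟨⊤, fun _ _ _ _ _ _ _ _ _ => trivial⟩
  bot := ⟨⊥, fun u₁ v₁ u₂ v₂ h₁ h₂ _ hu _ => by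
    obtain rfl : u₁ = u₂ := hu
    revert h₁ h₂
    unfold Precedes
    cases χ u₁ <;> cases χ v₁ <;> simp <;> omega⟩
  le_top π := show π.1 ≤ ⊤ from le_top
  bot_le π := show ⊥ ≤ π.1 from bot_le

/-- The block of `π` containing the node `a`. -/
def block (π : BNC χ) (a : Fin n) : Finset (Fin n) :=
  open Classical in Finset.univ.filter fun b => π.1 a b

/-- The nodes that are the smallest elements of their blocks (so they index the blocks of `π`),
listed in decreasing order. -/
def tops (π : BNC χ) : List (Fin n) :=
  open Classical in
  (Finset.univ.filter fun a => ∀ b ∈ π.block a, a ≤ b).sort fun a b => a ≥ b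

/-- At the height of the node `v`, the diagram of `π` has a (vertical) spine of the block of `w`:
this block has nodes both above and below `v`. -/
def SpineAt (π : BNC χ) (v w : Fin n) : Prop :=
  (∃ a ∈ π.block w, a < v) ∧ ∃ c ∈ π.block w, v < c

/-- Of two blocks having spines at the height of `v`, the spine of the block of `w` is to the left of
the spine of the block of `w'`. As the spines leave the height of `v` downwards and do not cross, this
means that the nodes below `v` of the first block come before those of the second one when the part of
the diagram below `v` is read down the left side and then up the right side. -/
def SpineLeftOf (π : BNC χ) (v w w' : Fin n) : Prop :=
  ∀ c ∈ π.block w, ∀ c' ∈ π.block w', v < c → v < c' → Precedes χ c c'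

/-- Among the blocks with top nodes in `rest`, the block of `w` has the spine that is adjacent
to the node `v`: the leftmost spine at this height if `v` is on the left, the rightmost one if `v` is
on the right. -/
def SpineAdjacent (π : BNC χ) (v : Fin n) (rest : List (Fin n)) (w : Fin n) : Prop :=
  w ∈ rest ∧ π.SpineAt v w ∧ ∀ w' ∈ rest, w' ≠ w → π.SpineAt v w' →
    match χ v with
    | Side.left => π.SpineLeftOf v w w'
    | Side.right => π.SpineLeftOf v w' w

/-- `j` is a node of one of the blocks with top nodes in `rest`. -/
def Remains (π : BNC χ) (rest : List (Fin n)) (j : Fin n) : Prop :=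
  ∃ w ∈ rest, j ∈ π.block w

/-- The remaining nodes all lie above `v`, and `j` is the last of them. -/
def IsLastAbove (π : BNC χ) (v : Fin n) (rest : List (Fin n)) (j : Fin n) : Prop :=
  π.Remains rest j ∧ ∀ i, π.Remains rest i → i < v ∧ i ≤ j

/-- `j` is the smallest element larger than `v` of the block whose spine is adjacent to `v`. -/
def IsFirstBelow (π : BNC χ) (v : Fin n) (rest : List (Fin n)) (j : Fin n) : Prop :=
  ∃ w, π.SpineAdjacent v rest w ∧ j ∈ π.block w ∧ v < j ∧ ∀ i ∈ π.block w, v < i → j ≤ i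

/-- The Möbius function of the lattice `BNC(χ)`. -/
def mu (σ π : BNC χ) : ℂ := IncidenceAlgebra.mu ℂ σ π

end BNC

/-! ### Cutting `{1, …, n}` into `m` intervals -/

/-- A sequence `k(0) = 0 < k(1) < ⋯ < k(m) = n`. -/
structure Cut (m n : ℕ) where
  k : Fin (m + 1) → ℕ
  strictMono : StrictMono k
  zero : k 0 = 0
  last : k (Fin.last m) = n

namespace Cut

variable {m n : ℕ} (k : Cut m n)

/-- Every node lies in exactly one interval (nodes are counted from `0` here, so the `p`-th interval
`k(p-1) < q ≤ k(p)` reads `k p.castSucc ≤ q < k p.succ`). -/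
theorem existsUnique_index (q : Fin n) :
    ∃! p : Fin m, k.k p.castSucc ≤ (q : ℕ) ∧ (q : ℕ) < k.k p.succ := by
  have key : ∀ i : Fin (m + 1), (q : ℕ) < k.k i →
      ∃ p : Fin m, k.k p.castSucc ≤ (q : ℕ) ∧ (q : ℕ) < k.k p.succ := by
    intro i
    induction i using Fin.induction with
    | zero => intro h; rw [k.zero] at h; omega
    | succ i ih =>
      intro h
      by_cases h' : (q : ℕ) < k.k i.castSucc
      · exact ih h'
      · exact ⟨i, not_lt.mp h', h⟩
  obtain ⟨p, hp⟩ := key (Fin.last m) (by rw [k.last]; exact q.2)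
  refine ⟨p, hp, ?_⟩
  have aux : ∀ p p' : Fin m, k.k p.castSucc ≤ (q : ℕ) → (q : ℕ) < k.k p'.succ → p ≤ p' := by
    intro p p' h h'
    have h2 := k.strictMono.lt_iff_lt.mp (lt_of_le_of_lt h h')
    rw [Fin.lt_def] at h2
    rw [Fin.le_def]
    simp at h2
    omega
  intro p' hp'
  exact le_antisymm (aux p' p hp'.1 hp.2) (aux p p' hp.1 hp'.2)

/-- The index `p_q` of the interval containing the node `q`. -/
def index (q : Fin n) : Fin m := (k.existsUnique_index q).choose

theorem index_spec (q : Fin n) :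
    k.k (k.index q).castSucc ≤ (q : ℕ) ∧ (q : ℕ) < k.k (k.index q).succ :=
  (k.existsUnique_index q).choose_spec.1

theorem index_mono : Monotone k.index := by
  intro q q' h
  have h1 := (k.index_spec q).1
  have h2 := (k.index_spec q').2
  have h3 : (q : ℕ) ≤ (q' : ℕ) := h
  have h4 := k.strictMono.lt_iff_lt.mp (lt_of_le_of_lt (h1.trans h3) h2)
  rw [Fin.lt_def] at h4
  rw [Fin.le_def]
  simp at h4
  omega

/-- The nodes of the `p`-th interval. -/
def interval (p : Fin m) : Finset (Fin n) := Finset.univ.filter fun q => k.index q = p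

/-- The side function `χ̂(q) = χ(p_q)`. -/
def expand (χ : Fin m → Side) : Fin n → Side := fun q => χ (k.index q)

theorem precedes_index {χ : Fin m → Side} {a b : Fin n} (h : Precedes (k.expand χ) a b) :
    k.index a = k.index b ∨ Precedes χ (k.index a) (k.index b) := by
  by_cases hab : k.index a = k.index b
  · exact Or.inl hab
  refine Or.inr ?_
  have h1 : a < b → k.index a < k.index b := fun h => lt_of_le_of_ne (k.index_mono h.le) hab
  have h2 : b < a → k.index b < k.index a :=
    fun h => lt_of_le_of_ne (k.index_mono h.le) (Ne.symm hab)
  revert h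
  unfold Precedes expand
  cases χ (k.index a) <;> cases χ (k.index b) <;> simp <;> assumption

/-- The embedding `π ↦ π̂` of `BNC(χ)` into `BNC(χ̂)` replacing the node `p` by the `p`-th interval:
`q` and `q'` are in the same block of `π̂` iff `p_q` and `p_{q'}` are in the same block of `π`. -/
def hat {χ : Fin m → Side} (π : BNC χ) : BNC (k.expand χ) :=
  ⟨Setoid.comap k.index π.1, by
    intro u₁ v₁ u₂ v₂ h₁ h₂ h₃ hu hv
    simp only [Setoid.comap_rel] at hu hv ⊢
    rcases k.precedes_index h₁ with e₁ | p₁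
    · rw [e₁]
    rcases k.precedes_index h₂ with e₂ | p₂
    · rwa [e₂]
    rcases k.precedes_index h₃ with e₃ | p₃
    · rw [e₃] at hu
      exact π.1.trans' hu (π.1.symm' hv)
    · exact π.2 _ _ _ _ p₁ p₂ p₃ hu hv⟩

end Cut

/-! ### `B`-`B`-non-commutative probability spaces -/

/-- The product `T_{i₁} T_{i₂} ⋯ T_{iₛ}` over the elements `i₁ < i₂ < ⋯ < iₛ` of `V`. -/
def orderedProd {A : Type*} [Monoid A] {n : ℕ} (T : Fin n → A) (V : Finset (Fin n)) : A :=
  ((V.sort fun a b => a ≤ b).map T).prod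

/-- A `B`-`B`-non-commutative probability space `(A, E, ε)`. -/
structure BBSpace (B A : Type*) [Ring B] [Algebra ℂ B] [Ring A] [Algebra ℂ A] where
  ε : B ⊗[ℂ] Bᵐᵒᵖ →ₐ[ℂ] A
  injective_left : Function.Injective fun b : B => ε (b ⊗ₜ[ℂ] 1)
  injective_right : Function.Injective fun b : Bᵐᵒᵖ => ε (1 ⊗ₜ[ℂ] b)
  E : A →ₗ[ℂ] B
  E_mul : ∀ (b₁ b₂ : B) (T : A), E (ε (b₁ ⊗ₜ[ℂ] MulOpposite.op b₂) * T) = b₁ * E T * b₂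
  E_comm : ∀ (b : B) (T : A), E (T * ε (b ⊗ₜ[ℂ] 1)) = E (T * ε (1 ⊗ₜ[ℂ] MulOpposite.op b))

namespace BBSpace

variable {B A : Type*} [Ring B] [Algebra ℂ B] [Ring A] [Algebra ℂ A] (𝒜 : BBSpace B A)

/-- `L_b = ε(b ⊗ 1)`. -/
def L (b : B) : A := 𝒜.ε (b ⊗ₜ[ℂ] 1)

/-- `R_b = ε(1 ⊗ b)`. -/
def R (b : B) : A := 𝒜.ε (1 ⊗ₜ[ℂ] MulOpposite.op b)

/-- `L_b` or `R_b`, according to the side. -/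
def coeff (s : Side) (b : B) : A :=
  match s with
  | Side.left => 𝒜.L b
  | Side.right => 𝒜.R b

/-- The left algebra consists of the elements commuting with all `R_b`, the right algebra of the
elements commuting with all `L_b`. -/
def face (s : Side) : Subalgebra ℂ A :=
  match s with
  | Side.left => Subalgebra.centralizer ℂ (Set.range 𝒜.R)
  | Side.right => Subalgebra.centralizer ℂ (Set.range 𝒜.L)

variable {n : ℕ} {χ : Fin n → Side}

/-- One step of the recursion for `E_π`: the block with top node `v` has been evaluated to `b`, and
`L_b` (if `v` is on the left) or `R_b` (if `v` is on the right) is multiplied into the entries of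
the remaining blocks. If all remaining nodes are above `v`, it is multiplied from the right to the
last of them; otherwise it is multiplied from the left to the first entry below `v` of the block whose
spine is adjacent to `v`. -/
def insert (π : BNC χ) (v : Fin n) (rest : List (Fin n)) (b : B) (T : Fin n → A) : Fin n → A :=
  open Classical in fun j =>
    if π.IsLastAbove v rest j then T j * 𝒜.coeff (χ v) b
    else if π.IsFirstBelow v rest j then 𝒜.coeff (χ v) b * T j
    else T j

/-- The recursion for `E_π`, over the list of the top nodes of the blocks that are still to be
evaluated, the block that terminates closest to the bottom coming first. (The empty list only
occurs for `n = 0`.) -/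
def momentAux (π : BNC χ) : List (Fin n) → (Fin n → A) → B
  | [], _ => 𝒜.E 1
  | [v], T => 𝒜.E (orderedProd T (π.block v))
  | v :: w :: rest, T =>
      momentAux π (w :: rest)
        (𝒜.insert π v (w :: rest) (𝒜.E (orderedProd T (π.block v))) T)

/-- `E_π(T₁, …, Tₙ)` for arbitrary `T₁, …, Tₙ ∈ A`. -/
def Epi (π : BNC χ) (T : Fin n → A) : B := 𝒜.momentAux π π.tops T

/-- The bi-free operator-valued moment function `𝓔_π(T₁, …, Tₙ)`, `T_k ∈ A_{χ(k)}`. -/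
def moment (π : BNC χ) (T : ∀ q, 𝒜.face (χ q)) : B := 𝒜.Epi π fun q => (T q : A)

/-- The operator-valued bi-free cumulant function `κ = 𝓔 * μ_BNC`, that is
`κ_π(T₁, …, Tₙ) = ∑_{σ ≤ π} 𝓔_σ(T₁, …, Tₙ) μ_BNC(σ, π)`. -/
def cumulant (π : BNC χ) (T : ∀ q, 𝒜.face (χ q)) : B :=
  ∑ σ : BNC χ with σ ≤ π, BNC.mu σ π • 𝒜.moment σ T

/-- The tuple `(T_1 ⋯ T_{k(1)}, T_{k(1)+1} ⋯ T_{k(2)}, …, T_{k(m-1)+1} ⋯ T_{k(m)})`. -/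
def products {m n : ℕ} (k : Cut m n) {χ : Fin m → Side}
    (T : ∀ q, 𝒜.face (k.expand χ q)) (p : Fin m) : 𝒜.face (χ p) :=
  ⟨orderedProd (fun q => (T q : A)) (k.interval p), by
    apply Subalgebra.list_prod_mem
    intro x hx
    obtain ⟨q, hq, rfl⟩ := List.mem_map.mp hx
    rw [Finset.mem_sort] at hq
    have hp : k.index q = p := by simpa [Cut.interval] using hq
    rw [← hp]
    exact (T q).2⟩

end BBSpace

end

end BiFree

namespace BiFree

noncomputable section

/-! ### The order structure of a cut -/

namespace Cut

variable {m n : ℕ} (k : Cut m n)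

/-! Two facts combine through Möbius inversion. Evaluating `𝓔_π` on the products gives `𝓔_π̂` on the
single entries (`moment_products`): the two recursions run in parallel. In the diagram of `π̂` each
node is stretched into an interval, and a coefficient lands at the right end of an interval (right
multiplication) or at its left end (left multiplication), so associativity absorbs it into the
product.

Next, `π ↦ π̂` is an order isomorphism from `BNC(χ)` onto the partitions above `0̂_χ`
(`hat_le_hat_iff`, `exists_hat_eq`). Hence `{σ ≤ π̂}` is the disjoint union over `ρ ≤ π` of the
fibres `{σ ∨ 0̂_χ = ρ̂}` (`sum_le_hat`). By the moment–cumulant formula, both sides of the theorem,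
summed over `ρ ≤ π`, equal `𝓔_π̂(T)`; functions with equal sums over all down-sets coincide. -/

theorem index_eq_iff {q : Fin n} {p : Fin m} :
    k.index q = p ↔ k.k p.castSucc ≤ (q : ℕ) ∧ (q : ℕ) < k.k p.succ := by
  constructor
  · rintro rfl
    exact k.index_spec q
  · exact fun h => (k.existsUnique_index q).unique (k.index_spec q) h

theorem lt_succ (p : Fin m) : k.k p.castSucc < k.k p.succ :=
  k.strictMono Fin.castSucc_lt_succ

theorem succ_le (p : Fin m) : k.k p.succ ≤ n :=
  (k.strictMono.monotone (Fin.le_last _)).trans_eq k.last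

/-- The smallest node of the `p`-th interval. -/
def first (p : Fin m) : Fin n := ⟨k.k p.castSucc, (k.lt_succ p).trans_le (k.succ_le p)⟩

/-- The largest node of the `p`-th interval. -/
def final (p : Fin m) : Fin n :=
  ⟨k.k p.succ - 1, by have := k.lt_succ p; have := k.succ_le p; omega⟩

@[simp]
theorem index_first (p : Fin m) : k.index (k.first p) = p :=
  k.index_eq_iff.2 ⟨le_rfl, k.lt_succ p⟩

@[simp]
theorem index_final (p : Fin m) : k.index (k.final p) = p :=
  k.index_eq_iff.2 (by have := k.lt_succ p; simp only [final]; omega)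

theorem first_le {q : Fin n} {p : Fin m} (h : k.index q = p) : k.first p ≤ q :=
  (k.index_eq_iff.1 h).1

theorem le_final {q : Fin n} {p : Fin m} (h : k.index q = p) : q ≤ k.final p := by
  have := (k.index_eq_iff.1 h).2
  rw [Fin.le_def]
  simp only [final]
  omega

theorem lt_of_index_lt {a b : Fin n} (h : k.index a < k.index b) : a < b := by
  by_contra h'
  exact absurd (k.index_mono (not_lt.1 h')) (not_le.2 h)

theorem lt_iff_index_lt {a b : Fin n} (h : k.index a ≠ k.index b) :
    a < b ↔ k.index a < k.index b :=
  ⟨fun h' => lt_of_le_of_ne (k.index_mono h'.le) h, k.lt_of_index_lt⟩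

theorem lt_first_iff {q : Fin n} {p : Fin m} : q < k.first p ↔ k.index q < p := by
  constructor
  · intro h
    have h1 := k.index_mono h.le
    rw [index_first] at h1
    exact lt_of_le_of_ne h1 fun e => absurd (k.first_le e) (not_le.2 h)
  · intro h
    exact k.lt_of_index_lt (by simpa using h)

theorem first_le_iff {q : Fin n} {p : Fin m} : k.first p ≤ q ↔ p ≤ k.index q := by
  rw [← not_lt, lt_first_iff, not_lt]

theorem le_final_iff {q : Fin n} {p : Fin m} : q ≤ k.final p ↔ k.index q ≤ p := by
  constructor
  · intro h
    simpa using k.index_mono h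
  · intro h
    rcases h.lt_or_eq with h | h
    · exact (k.lt_of_index_lt (by simpa using h)).le
    · exact k.le_final h

theorem first_lt_iff {q : Fin n} {p : Fin m} (h : k.index q ≠ p) :
    k.first p < q ↔ p < k.index q := by
  simpa using k.lt_iff_index_lt (a := k.first p) (b := q) (by simpa using h.symm)

theorem first_strictMono : StrictMono k.first := fun p p' h =>
  k.lt_of_index_lt (by simpa using h)

theorem mem_interval {q : Fin n} {p : Fin m} : q ∈ k.interval p ↔ k.index q = p := by
  simp [interval]

theorem precedes_expand_iff {χ : Fin m → Side} {a b : Fin n} (h : k.index a ≠ k.index b) :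
    Precedes (k.expand χ) a b ↔ Precedes χ (k.index a) (k.index b) := by
  have h1 := k.lt_iff_index_lt h
  have h2 := k.lt_iff_index_lt h.symm
  unfold Precedes expand
  cases χ (k.index a) <;> cases χ (k.index b) <;> simp [h1, h2]

/-! ### The embedding of lattices -/

variable {χ : Fin m → Side}

theorem hat_rel (π : BNC χ) (a b : Fin n) :
    (k.hat π).1 a b ↔ π.1 (k.index a) (k.index b) := Iff.rfl

theorem hat_le_hat_iff {π ρ : BNC χ} : k.hat π ≤ k.hat ρ ↔ π ≤ ρ := by
  constructor
  · intro h a b hab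
    have := @h (k.first a) (k.first b) (by simpa [hat_rel] using hab)
    simpa [hat_rel] using this
  · intro h a b hab
    exact @h (k.index a) (k.index b) hab

theorem hat_injective : Function.Injective (k.hat (χ := χ)) := fun _ _ h =>
  le_antisymm (k.hat_le_hat_iff.1 h.le) (k.hat_le_hat_iff.1 h.ge)

theorem hat_top : k.hat (⊤ : BNC χ) = ⊤ :=
  top_le_iff.1 fun _ _ _ => trivial

/-- Every node is `σ`-equivalent to the first node of its interval, so `σ` is recovered from its
restriction to first nodes. That restriction is bi-non-crossing because `first` preserves `≺`. -/
theorem exists_hat_eq {σ : BNC (k.expand χ)} (hσ : k.hat (⊥ : BNC χ) ≤ σ) :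
    ∃ ρ : BNC χ, k.hat ρ = σ := by
  have hrel : ∀ q : Fin n, σ.1 (k.first (k.index q)) q := fun q =>
    @hσ _ _ (show k.index (k.first (k.index q)) = k.index q by simp)
  have hprec : ∀ {a b : Fin m}, Precedes χ a b →
      Precedes (k.expand χ) (k.first a) (k.first b) := by
    intro a b h
    by_cases hab : a = b
    · subst hab
      revert h
      unfold Precedes expand
      cases h : χ a <;> simp [h]
    · exact (k.precedes_expand_iff (by simpa using hab)).2 (by simpa using h)
  refine ⟨⟨Setoid.comap k.first σ.1, ?_⟩, ?_⟩
  · intro u₁ v₁ u₂ v₂ h₁ h₂ h₃ hu hv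
    exact σ.2 _ _ _ _ (hprec h₁) (hprec h₂) (hprec h₃) hu hv
  · apply Subtype.ext
    apply Setoid.ext
    intro a b
    change σ.1 (k.first (k.index a)) (k.first (k.index b)) ↔ _
    exact ⟨fun h => σ.1.trans' (σ.1.trans' (σ.1.symm' (hrel a)) h) (hrel b),
      fun h => σ.1.trans' (σ.1.trans' (hrel a) h) (σ.1.symm' (hrel b))⟩

/-! ### The diagrams of `π` and `π̂` -/

theorem _root_.BiFree.BNC.mem_block {n : ℕ} {χ : Fin n → Side} {π : BNC χ} {a b : Fin n} :
    b ∈ π.block a ↔ π.1 a b := by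
  simp [BNC.block]

theorem mem_block_hat_first {π : BNC χ} {w : Fin m} {q : Fin n} :
    q ∈ (k.hat π).block (k.first w) ↔ k.index q ∈ π.block w := by
  simp [BNC.mem_block, hat_rel]

theorem tops_hat (π : BNC χ) : (k.hat π).tops = π.tops.map k.first := by
  classical
  have hs : (π.tops.map k.first).Pairwise (· ≥ ·) := by
    rw [List.pairwise_map]
    exact (Finset.pairwise_sort _ _).imp fun h => k.first_strictMono.monotone h
  refine List.Perm.eq_of_pairwise' (r := (· ≥ ·)) (Finset.pairwise_sort _ _) hs ?_
  refine (List.perm_ext_iff_of_nodup (Finset.sort_nodup _ _)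
    ((Finset.sort_nodup _ _).map k.first_strictMono.injective)).2 fun q => ?_
  simp only [Finset.mem_sort, List.mem_map, Finset.mem_filter, Finset.mem_univ,
    true_and, BNC.mem_block, hat_rel]
  constructor
  · intro h
    have hq : k.first (k.index q) = q :=
      le_antisymm (k.first_le rfl) (h _ (by simp))
    refine ⟨k.index q, fun b hb => ?_, hq⟩
    simpa using k.index_mono (h (k.first b) (by simpa using hb))
  · rintro ⟨p, hp, rfl⟩ b hb
    exact k.first_le_iff.2 (hp _ (by simpa using hb))

theorem remains_hat {π : BNC χ} {rest : List (Fin m)} {q : Fin n} :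
    (k.hat π).Remains (rest.map k.first) q ↔ π.Remains rest (k.index q) := by
  simp [BNC.Remains, mem_block_hat_first]

/-- Among the stretched nodes, the last remaining one is the right end of its interval, which is
where right multiplication must act. -/
theorem isLastAbove_hat {π : BNC χ} {v : Fin m} {rest : List (Fin m)} {q : Fin n} :
    (k.hat π).IsLastAbove (k.first v) (rest.map k.first) q ↔
      π.IsLastAbove v rest (k.index q) ∧ q = k.final (k.index q) := by
  simp only [BNC.IsLastAbove, remains_hat, lt_first_iff]
  constructor
  · rintro ⟨h1, h2⟩
    refine ⟨⟨h1, fun i hi => ?_⟩, le_antisymm (k.le_final rfl) (h2 _ (by simpa using h1)).2⟩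
    have := h2 (k.first i) (by simpa using hi)
    exact ⟨by simpa using this.1, by simpa using k.index_mono this.2⟩
  · rintro ⟨⟨h1, h2⟩, h3⟩
    refine ⟨h1, fun i hi => ⟨(h2 _ hi).1, ?_⟩⟩
    rw [h3]
    exact k.le_final_iff.2 (h2 _ hi).2

/-- If `v` were in the block of `w`, the other nodes of its own interval would count as nodes below
`k.first v`; the hypothesis excludes this. -/
theorem spineAt_hat {π : BNC χ} {v w : Fin m} (h : ¬ π.1 v w) :
    (k.hat π).SpineAt (k.first v) (k.first w) ↔ π.SpineAt v w := by
  have hne : ∀ c : Fin n, k.index c ∈ π.block w → k.index c ≠ v := by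
    rintro c hc rfl
    exact h (π.1.symm' (BNC.mem_block.1 hc))
  simp only [BNC.SpineAt, mem_block_hat_first, lt_first_iff]
  refine and_congr ⟨?_, ?_⟩ ⟨?_, ?_⟩
  · rintro ⟨a, ha, hav⟩
    exact ⟨_, ha, hav⟩
  · rintro ⟨a, ha, hav⟩
    exact ⟨k.first a, by simpa using ha, by simpa using hav⟩
  · rintro ⟨c, hc, hvc⟩
    exact ⟨_, hc, (k.first_lt_iff (hne c hc)).1 hvc⟩
  · rintro ⟨c, hc, hvc⟩
    exact ⟨k.first c, by simpa using hc, k.first_strictMono hvc⟩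

theorem spineLeftOf_hat {π : BNC χ} {v w w' : Fin m} (h : ¬ π.1 v w) (h' : ¬ π.1 v w')
    (hw : ¬ π.1 w w') :
    (k.hat π).SpineLeftOf (k.first v) (k.first w) (k.first w') ↔ π.SpineLeftOf v w w' := by
  have hne : ∀ {u : Fin m}, ¬ π.1 v u → ∀ c : Fin n, k.index c ∈ π.block u → k.index c ≠ v := by
    rintro u hu c hc rfl
    exact hu (π.1.symm' (BNC.mem_block.1 hc))
  have hcc : ∀ {c c' : Fin m}, c ∈ π.block w → c' ∈ π.block w' → c ≠ c' := by
    rintro c _ hc hc' rfl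
    exact hw (π.1.trans' (BNC.mem_block.1 hc) (π.1.symm' (BNC.mem_block.1 hc')))
  simp only [BNC.SpineLeftOf, mem_block_hat_first]
  constructor
  · intro H c hc c' hc' hvc hvc'
    simpa using (k.precedes_expand_iff (by simpa using hcc hc hc')).1
      (H (k.first c) (by simpa using hc) (k.first c') (by simpa using hc')
      (k.first_strictMono hvc) (k.first_strictMono hvc'))
  · intro H c hc c' hc' hvc hvc'
    exact (k.precedes_expand_iff (hcc hc hc')).2
      (H _ hc _ hc' ((k.first_lt_iff (hne h c hc)).1 hvc)
        ((k.first_lt_iff (hne h' c' hc')).1 hvc'))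

theorem spineAdjacent_hat {π : BNC χ} {v w : Fin m} {rest : List (Fin m)}
    (hv : ∀ u ∈ rest, ¬ π.1 v u) (hrest : rest.Pairwise fun a b => ¬ π.1 a b) :
    (k.hat π).SpineAdjacent (k.first v) (rest.map k.first) (k.first w) ↔
      π.SpineAdjacent v rest w := by
  have hrest' : ∀ a ∈ rest, ∀ b ∈ rest, a ≠ b → ¬ π.1 a b := fun a ha b hb hab =>
    -- Symmetry turns pairwise inequivalence in list order into inequivalence of any two distinct
    -- members.
    have : Std.Symm fun a b => ¬ π.1 a b := ⟨fun _ _ h h' => h (π.1.symm' h')⟩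
    hrest.forall ha hb hab
  simp only [BNC.SpineAdjacent, List.mem_map_of_injective k.first_strictMono.injective,
    List.forall_mem_map, k.first_strictMono.injective.ne_iff]
  refine and_congr_right fun hw => and_congr (k.spineAt_hat (hv w hw)) ?_
  refine forall₂_congr fun w' hw' => forall_congr' fun hne =>
    imp_congr (k.spineAt_hat (hv w' hw')) ?_
  have hχ : k.expand χ (k.first v) = χ v := by simp [expand]
  rw [hχ]
  cases χ v
  · exact k.spineLeftOf_hat (hv w hw) (hv w' hw') (hrest' _ hw _ hw' hne.symm)
  · exact k.spineLeftOf_hat (hv w' hw') (hv w hw) (hrest' _ hw' _ hw hne)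

theorem isFirstBelow_hat {π : BNC χ} {v : Fin m} {rest : List (Fin m)} {q : Fin n}
    (hv : ∀ u ∈ rest, ¬ π.1 v u) (hrest : rest.Pairwise fun a b => ¬ π.1 a b) :
    (k.hat π).IsFirstBelow (k.first v) (rest.map k.first) q ↔
      π.IsFirstBelow v rest (k.index q) ∧ q = k.first (k.index q) := by
  have hne : ∀ {w}, w ∈ rest → ∀ c : Fin n, k.index c ∈ π.block w → k.index c ≠ v := by
    rintro u hu c hc rfl
    exact hv u hu (π.1.symm' (BNC.mem_block.1 hc))
  simp only [BNC.IsFirstBelow]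
  constructor
  · rintro ⟨w', hw', hq, hvq, hmin⟩
    obtain ⟨w, hw, rfl⟩ := List.mem_map.1 hw'.1
    rw [mem_block_hat_first] at hq
    have hvq' := (k.first_lt_iff (hne hw q hq)).1 hvq
    refine ⟨⟨w, (k.spineAdjacent_hat hv hrest).1 hw', hq, hvq', fun i hi hvi => ?_⟩, ?_⟩
    · simpa using k.index_mono
        (hmin (k.first i) (by simpa [mem_block_hat_first] using hi) (k.first_strictMono hvi))
    · refine le_antisymm (hmin _ ?_ (k.first_strictMono hvq')) (k.first_le rfl)
      simpa [mem_block_hat_first] using hq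
  · rintro ⟨⟨w, hw, hq, hvq, hmin⟩, hfirst⟩
    refine ⟨k.first w, (k.spineAdjacent_hat hv hrest).2 hw, k.mem_block_hat_first.2 hq,
      (k.first_lt_iff (hne hw.1 q hq)).2 hvq, fun i hi hvi => ?_⟩
    rw [mem_block_hat_first] at hi
    rw [hfirst]
    exact k.first_le_iff.2 (hmin _ hi ((k.first_lt_iff (hne hw.1 i hi)).1 hvi))

end Cut

/-! ### Ordered products -/

section OrderedProd

variable {A : Type*} [Monoid A] {n : ℕ}

theorem orderedProd_congr {S T : Fin n → A} {V : Finset (Fin n)} (h : ∀ q ∈ V, S q = T q) :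
    orderedProd S V = orderedProd T V := by
  unfold orderedProd
  rw [List.map_congr_left fun q hq => h q ((Finset.mem_sort _).1 hq)]

theorem orderedProd_eq_of_pairwise (T : Fin n → A) {V : Finset (Fin n)} {l : List (Fin n)}
    (hl : l.Pairwise (· < ·)) (hV : ∀ q, q ∈ V ↔ q ∈ l) : orderedProd T V = (l.map T).prod := by
  unfold orderedProd
  congr 2
  refine List.Perm.eq_of_pairwise' (r := (· ≤ ·)) (Finset.pairwise_sort _ _)
    (hl.imp fun h => le_of_lt h) ?_
  refine (List.perm_ext_iff_of_nodup (Finset.sort_nodup _ _) (hl.imp fun h => ne_of_lt h)).2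
    fun q => ?_
  rw [Finset.mem_sort, hV]

theorem pairwise_lt_sort (V : Finset (Fin n)) : (V.sort fun a b => a ≤ b).Pairwise (· < ·) :=
  ((Finset.pairwise_sort V _).and (Finset.sort_nodup V _)).imp fun h => lt_of_le_of_ne h.1 h.2

theorem orderedProd_of_isGreatest (T : Fin n → A) {V : Finset (Fin n)} {j : Fin n} (hj : j ∈ V)
    (h : ∀ q ∈ V, q ≤ j) : orderedProd T V = orderedProd T (V.erase j) * T j := by
  rw [orderedProd_eq_of_pairwise T (l := ((V.erase j).sort fun a b => a ≤ b) ++ [j])]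
  · simp [orderedProd]
  · rw [List.pairwise_append]
    refine ⟨pairwise_lt_sort _, by simp, fun a ha b hb => ?_⟩
    rw [Finset.mem_sort, Finset.mem_erase] at ha
    rw [List.mem_singleton.1 hb]
    exact lt_of_le_of_ne (h a ha.2) ha.1
  · intro q
    by_cases hq : q = j <;> simp [hq, hj]

theorem orderedProd_of_isLeast (T : Fin n → A) {V : Finset (Fin n)} {j : Fin n} (hj : j ∈ V)
    (h : ∀ q ∈ V, j ≤ q) : orderedProd T V = T j * orderedProd T (V.erase j) := by
  rw [orderedProd_eq_of_pairwise T (l := j :: ((V.erase j).sort fun a b => a ≤ b))]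
  · simp [orderedProd]
  · rw [List.pairwise_cons]
    refine ⟨fun a ha => ?_, pairwise_lt_sort _⟩
    rw [Finset.mem_sort, Finset.mem_erase] at ha
    exact lt_of_le_of_ne (h a ha.2) (Ne.symm ha.1)
  · intro q
    by_cases hq : q = j <;> simp [hq, hj]

/-- Since `index` is monotone, concatenating the sorted intervals in the order of `p` already gives
a sorted list. -/
theorem orderedProd_index_preimage {m : ℕ} (k : Cut m n) (T : Fin n → A) {V : Finset (Fin m)}
    {W : Finset (Fin n)} (hW : ∀ q, q ∈ W ↔ k.index q ∈ V) :
    orderedProd T W = orderedProd (fun p => orderedProd T (k.interval p)) V := by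
  rw [orderedProd_eq_of_pairwise T
    (l := (V.sort fun a b => a ≤ b).flatMap fun p => (k.interval p).sort fun a b => a ≤ b)]
  · simp [orderedProd, List.flatMap_def, List.prod_flatten, Function.comp_def]
  · rw [List.pairwise_flatMap]
    refine ⟨fun p _ => pairwise_lt_sort _, (pairwise_lt_sort V).imp fun {p p'} hp q hq q' hq' => ?_⟩
    rw [Finset.mem_sort, Cut.mem_interval] at hq hq'
    exact k.lt_of_index_lt (by rwa [hq, hq'])
  · intro q
    simp [hW, Cut.mem_interval]

end OrderedProd

/-! ### The moment function and products of consecutive entries -/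

namespace BBSpace

variable {B A : Type*} [Ring B] [Algebra ℂ B] [Ring A] [Algebra ℂ A] (𝒜 : BBSpace B A)

section Moment

variable {m n : ℕ} (k : Cut m n) {χ : Fin m → Side}

/-- Insertion commutes with multiplying out intervals: at most one entry of an interval changes, the
last (on its right) or the first (on its left), so the coefficient sits at an end of the product. -/
theorem orderedProd_insert_hat (π : BNC χ) {v : Fin m} {rest : List (Fin m)}
    (hv : ∀ u ∈ rest, ¬ π.1 v u) (hrest : rest.Pairwise fun a b => ¬ π.1 a b) (b : B)
    (T : Fin n → A) (p : Fin m) :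
    orderedProd (𝒜.insert (k.hat π) (k.first v) (rest.map k.first) b T) (k.interval p) =
      𝒜.insert π v rest b (fun p => orderedProd T (k.interval p)) p := by
  classical
  have hχ : k.expand χ (k.first v) = χ v := by simp [Cut.expand]
  have hins : 𝒜.insert (k.hat π) (k.first v) (rest.map k.first) b T = fun q =>
      if π.IsLastAbove v rest (k.index q) ∧ q = k.final (k.index q) then
        T q * 𝒜.coeff (χ v) b
      else if π.IsFirstBelow v rest (k.index q) ∧ q = k.first (k.index q) then
        𝒜.coeff (χ v) b * T q
      else T q := by
    funext q
    simp only [BBSpace.insert, k.isLastAbove_hat, k.isFirstBelow_hat hv hrest, hχ]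
  rw [hins]
  simp only [BBSpace.insert]
  split_ifs with h1 h2
  · have h2 : ¬ π.IsFirstBelow v rest p := by
      rintro ⟨w, hw, hp, hvp, -⟩
      exact absurd (h1.2 p ⟨w, hw.1, hp⟩).1 hvp.not_gt
    have hmem : k.final p ∈ k.interval p := by simp [Cut.mem_interval]
    have hle : ∀ q ∈ k.interval p, q ≤ k.final p := fun q hq => k.le_final (k.mem_interval.1 hq)
    rw [orderedProd_of_isGreatest _ hmem hle, orderedProd_of_isGreatest T hmem hle, mul_assoc]
    congr 1
    · refine orderedProd_congr fun q hq => ?_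
      rw [Finset.mem_erase, Cut.mem_interval] at hq
      obtain ⟨hq, rfl⟩ := hq
      simp [hq, h2]
    · simp [h1]
  · have hmem : k.first p ∈ k.interval p := by simp [Cut.mem_interval]
    have hle : ∀ q ∈ k.interval p, k.first p ≤ q := fun q hq => k.first_le (k.mem_interval.1 hq)
    rw [orderedProd_of_isLeast _ hmem hle, orderedProd_of_isLeast T hmem hle, ← mul_assoc]
    congr 1
    · simp [h1, h2]
    · refine orderedProd_congr fun q hq => ?_
      rw [Finset.mem_erase, Cut.mem_interval] at hq
      obtain ⟨hq, rfl⟩ := hq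
      simp [hq, h1]
  · refine orderedProd_congr fun q hq => ?_
    rw [Cut.mem_interval] at hq
    subst hq
    simp [h1, h2]

omit [Algebra ℂ A] in
theorem orderedProd_block_hat (π : BNC χ) (v : Fin m) (T : Fin n → A) :
    orderedProd T ((k.hat π).block (k.first v)) =
      orderedProd (fun p => orderedProd T (k.interval p)) (π.block v) :=
  orderedProd_index_preimage k T fun _ => k.mem_block_hat_first

/-- Induction with `T` arbitrary, because each step passes a modified tuple to the next. -/
theorem momentAux_hat (π : BNC χ) (l : List (Fin m)) (hl : l.Pairwise fun a b => ¬ π.1 a b)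
    (T : Fin n → A) :
    𝒜.momentAux (k.hat π) (l.map k.first) T =
      𝒜.momentAux π l fun p => orderedProd T (k.interval p) := by
  induction l generalizing T with
  | nil => rfl
  | cons v l ih =>
    rw [List.pairwise_cons] at hl
    cases l with
    | nil => simp only [List.map, momentAux, orderedProd_block_hat]
    | cons w rest =>
      have h := ih hl.2 (𝒜.insert (k.hat π) (k.first v) ((w :: rest).map k.first)
        (𝒜.E (orderedProd T ((k.hat π).block (k.first v)))) T)
      simp only [orderedProd_insert_hat 𝒜 k π hl.1 hl.2, orderedProd_block_hat] at h
      simp only [List.map_cons, momentAux, orderedProd_block_hat] at h ⊢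
      exact h

theorem tops_pairwise {n : ℕ} {χ : Fin n → Side} (π : BNC χ) :
    π.tops.Pairwise fun a b => ¬ π.1 a b := by
  classical
  have hmem : ∀ {a}, a ∈ π.tops → ∀ b, π.1 a b → a ≤ b := by
    intro a ha b hab
    simp only [BNC.tops, Finset.mem_sort, Finset.mem_filter, BNC.mem_block] at ha
    exact ha.2 b hab
  refine (Finset.sort_nodup _ _).imp_of_mem fun {a b} ha hb hne hab => hne ?_
  exact le_antisymm (hmem ha b hab) (hmem hb a (π.1.symm' hab))

theorem moment_products (π : BNC χ) (T : ∀ q, 𝒜.face (k.expand χ q)) :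
    𝒜.moment π (𝒜.products k T) = 𝒜.moment (k.hat π) T := by
  unfold moment Epi
  rw [k.tops_hat, momentAux_hat 𝒜 k π _ (tops_pairwise π)]
  rfl

end Moment

/-- The moment–cumulant formula. -/
theorem sum_cumulant {n : ℕ} {χ : Fin n → Side} (π : BNC χ) (T : ∀ q, 𝒜.face (χ q)) :
    ∑ ρ : BNC χ with ρ ≤ π, 𝒜.cumulant ρ T = 𝒜.moment π T := by
  unfold cumulant
  -- After the exchange, the coefficient of `𝓔_σ` is the sum of `μ(σ, ρ)` over `ρ ∈ [σ, π]`, which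
  -- is `1` for `σ = π` and `0` otherwise.
  rw [Finset.sum_comm' (t' := Finset.univ.filter (· ≤ π)) (s' := fun σ => Finset.Icc σ π)
    (by
      intro ρ σ
      simp only [Finset.mem_filter, Finset.mem_univ, true_and, Finset.mem_Icc]
      exact ⟨fun h => ⟨⟨h.2, h.1⟩, h.2.trans h.1⟩, fun h => ⟨h.1.2, h.1.1⟩⟩)]
  simp only [BNC.mu, ← Finset.sum_smul, IncidenceAlgebra.sum_Icc_mu_right]
  simp

end BBSpace

/-! ### Comparing sums over down-sets -/

/-- The uniqueness half of Möbius inversion: by well-founded induction the terms strictly below `x`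
cancel. -/
theorem eq_of_sum_le_eq {P M : Type*} [PartialOrder P] [Fintype P] [DecidableLE P]
    [AddCommGroup M] {f g : P → M}
    (h : ∀ x, ∑ y : P with y ≤ x, f y = ∑ y : P with y ≤ x, g y) (x : P) : f x = g x := by
  classical
  induction x using WellFoundedLT.induction with
  | ind x ih =>
    have hx := h x
    have hmem : x ∈ Finset.univ.filter (· ≤ x) := by simp
    rw [← Finset.add_sum_erase _ _ hmem, ← Finset.add_sum_erase _ _ hmem] at hx
    rw [Finset.sum_congr rfl fun y hy => ih y ?_] at hx
    · exact add_right_cancel hx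
    · rw [Finset.mem_erase, Finset.mem_filter] at hy
      exact lt_of_le_of_ne hy.2.2 hy.1

/-- Each `σ ∨ 0̂_χ` is `ρ̂` for exactly one `ρ`. As `0̂_χ ≤ π̂`, the condition `σ ≤ π̂` amounts to
`ρ̂ ≤ π̂`, that is, `ρ ≤ π`. -/
theorem Cut.sum_le_hat {m n : ℕ} (k : Cut m n) {χ : Fin m → Side} {M : Type*} [AddCommMonoid M]
    (f : BNC (k.expand χ) → M) (π : BNC χ) :
    ∑ σ : BNC (k.expand χ) with σ ≤ k.hat π, f σ =
      ∑ ρ : BNC χ with ρ ≤ π,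
        ∑ σ : BNC (k.expand χ) with σ ⊔ k.hat (⊥ : BNC χ) = k.hat ρ, f σ := by
  classical
  rw [← Finset.sum_biUnion]
  · refine Finset.sum_congr ?_ fun _ _ => rfl
    ext σ
    simp only [Finset.mem_biUnion, Finset.mem_filter, Finset.mem_univ, true_and]
    constructor
    · intro h
      obtain ⟨ρ, hρ⟩ := k.exists_hat_eq (le_sup_right : _ ≤ σ ⊔ k.hat (⊥ : BNC χ))
      refine ⟨ρ, k.hat_le_hat_iff.1 ?_, hρ.symm⟩
      rw [hρ]
      exact sup_le h (k.hat_le_hat_iff.2 bot_le)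
    · rintro ⟨ρ, hρ, h⟩
      exact le_sup_left.trans (h.le.trans (k.hat_le_hat_iff.2 hρ))
  · intro ρ _ ρ' _ hne
    refine Finset.disjoint_left.2 fun σ h h' => hne (k.hat_injective ?_)
    rw [Finset.mem_filter] at h h'
    exact h.2.symm.trans h'.2

end

end BiFree

theorem mainTheorem8 {B A : Type*} [Ring B] [Algebra ℂ B] [Ring A] [Algebra ℂ A]
    (𝒜 : BiFree.BBSpace B A) {m n : ℕ} (hmn : m < n) (χ : Fin m → BiFree.Side)
    (k : BiFree.Cut m n) (T : ∀ q : Fin n, 𝒜.face (k.expand χ q)) :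
    (∀ π : BiFree.BNC χ,
      𝒜.cumulant π (𝒜.products k T) =
        ∑ σ : BiFree.BNC (k.expand χ) with σ ⊔ k.hat (⊥ : BiFree.BNC χ) = k.hat π,
          𝒜.cumulant σ T) ∧
    𝒜.cumulant (⊤ : BiFree.BNC χ) (𝒜.products k T) =
      ∑ σ : BiFree.BNC (k.expand χ) with
          σ ⊔ k.hat (⊥ : BiFree.BNC χ) = (⊤ : BiFree.BNC (k.expand χ)),
        𝒜.cumulant σ T := by
  have key : ∀ π : BiFree.BNC χ, 𝒜.cumulant π (𝒜.products k T) =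
      ∑ σ : BiFree.BNC (k.expand χ) with σ ⊔ k.hat (⊥ : BiFree.BNC χ) = k.hat π,
        𝒜.cumulant σ T := by
    refine BiFree.eq_of_sum_le_eq fun π => ?_
    -- Left side: `𝓔_π` of the products, equal to `𝓔_π̂(T)`. This is expanded into the cumulants
    -- `κ_σ(T)` with `σ ≤ π̂`, then grouped by `σ ∨ 0̂_χ`.
    rw [𝒜.sum_cumulant, 𝒜.moment_products, ← 𝒜.sum_cumulant, k.sum_le_hat]
  refine ⟨key, ?_⟩
  rw [key, k.hat_top]
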